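/- Let $U$ be a first-order structure and let $M \subseteq U$ be a strongly minimal set (that is, $M$ is infinite, definable with parameters, and in every elementary extension $U' \succeq U$ every subset of $M(U')$ definable with parameters is finite or cofinite in $M(U')$; the case $M = U$ is that of a strongly minimal structure). Assume that $\operatorname{acl}(\emptyset) \cap M \neq \emptyset$. For $K \subseteq U$, a groupoid definable over $K$ is a groupoid $X_\bullet = (X_0, X_1)$ whose sets of objects $X_0$ and of arrows $X_1$ are subsets of finite Cartesian powers of $U$ definable over $K$, and whose structure maps (source, target, composition, inverse, identity) are definable over $K$; $[X_\bullet]$ denotes the quotient of $X_0$ by the relation "there is an arrow from $x$ to $y$". A Morita morphism over $K$ is a functor given by maps definable over $K$ that is fully faithful and surjective on objects; $X_\bullet$ and $Y_\bullet$ are Morita equivalent over $K$ if there are a groupoid $Z_\bullet$ definable over $K$ and Morita morphisms $Z_\bullet \to X_\bullet$ and $Z_\bullet \to Y_\bullet$ over $K$. "Definable" without qualification means definable with parameters, i.e. over $K = U$. 1. Every definable groupoid $X_\bullet$ with $X_0 \subseteq M^n$ for some $n$ is Morita equivalent to a definable groupoid $Y_\bullet$ such that the map $Y_0 \to [Y_\bullet]$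 is finite, i.e. has finite fibres, of bounded size. 2. (Control of parameters, generalising the weak elimination of imaginaries of Lascar and Pillay.) If $K \subseteq U$ is such that $M$ is definable over $K$ and $\operatorname{acl}(K) \cap M$ is infinite, then every groupoid $X_\bullet$ definable over $K$ with $X_0 \subseteq M^n$ for some $n$ is Morita equivalent over $K$ to a groupoid $Y_\bullet$ definable over $K$ such that the map $Y_0 \to [Y_\bullet]$ has finite fibres, of bounded size. -/

import Mathlib

open FirstOrder

universe u v w

namespace DefGroupoid

section

variable (L : FirstOrder.Language.{u, v}) {U : Type w} [L.Structure U]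

/-- The algebraic closure `acl(A)` inside the structure `U`: the elements that lie in some finite
set definable over `A`. -/
def acl (A : Set U) : Set U :=
  {a | ∃ S : Set U, A.Definable₁ L S ∧ S.Finite ∧ a ∈ S}

/-- The set of points in an elementary extension `j : U ↪ₑ[L] N` of the set defined in `U` by the
formula `φ`, whose parameters are the free variables indexed by `U`. -/
def extend {N : Type*} [L.Structure N] (j : U ↪ₑ[L] N) (φ : L.Formula (U ⊕ Unit)) : Set N :=
  {x | φ.Realize (Sum.elim j (fun _ => x))}

/-- A subset `M` of `U` is strongly minimal if it is infinite, definable (with parameters), and in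
every elementary extension `N` of `U` every definable (with parameters) subset of `M(N)` is finite
or cofinite in `M(N)`. A strongly minimal structure is the case `M = U`. The set `M(N)` does not
depend on the formula that defines `M`. -/
def StronglyMinimal (M : Set U) : Prop :=
  M.Infinite ∧ ∃ φ : L.Formula (U ⊕ Unit),
    M = {x | φ.Realize (Sum.elim id (fun _ => x))} ∧
    ∀ (N : Type (max u v w)) [L.Structure N] (j : U ↪ₑ[L] N) (S : Set N),
      (Set.univ : Set N).Definable₁ L S →
        (extend L j φ ∩ S).Finite ∨ (extend L j φ \ S).Finite

/-- A map between subsets of powers of `U` is definable over `A` if its graph is. -/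
def DefinableMap (A : Set U) {α β : Type*} {s : Set (α → U)} {t : Set (β → U)} (f : s → t) : Prop :=
  A.Definable L {z : α ⊕ β → U | ∃ x : s, z = Sum.elim x.1 (f x).1}

/-- A groupoid internal to the category of sets and maps definable in `U` over `A`: the sets
`X₀ = Obj` and `X₁ = Arr`, with source, target, composition `comp g h = g ∘ h` (defined when the
source of `g` is the target of `h`), inverse and identities. -/
structure DefinableGroupoid (A : Set U) where
  n₀ : ℕ
  n₁ : ℕ
  Obj : Set (Fin n₀ → U)
  Arr : Set (Fin n₁ → U)
  src : Arr → Obj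
  tgt : Arr → Obj
  comp : (g h : Arr) → src g = tgt h → Arr
  inv : Arr → Arr
  one : Obj → Arr
  src_comp : ∀ g h e, src (comp g h e) = src h
  tgt_comp : ∀ g h e, tgt (comp g h e) = tgt g
  src_one : ∀ x, src (one x) = x
  tgt_one : ∀ x, tgt (one x) = x
  src_inv : ∀ g, src (inv g) = tgt g
  tgt_inv : ∀ g, tgt (inv g) = src g
  comp_assoc : ∀ g h k (e : src g = tgt h) (e' : src h = tgt k),
    comp (comp g h e) k ((src_comp g h e).trans e') =
      comp g (comp h k e') (e.trans (tgt_comp h k e').symm)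
  one_comp : ∀ g, comp (one (tgt g)) g (src_one _) = g
  comp_one : ∀ g, comp g (one (src g)) (tgt_one _).symm = g
  inv_comp : ∀ g, comp (inv g) g (src_inv g) = one (src g)
  comp_inv : ∀ g, comp g (inv g) (tgt_inv g).symm = one (tgt g)
  definable_Obj : A.Definable L Obj
  definable_Arr : A.Definable L Arr
  definable_src : DefinableMap L A src
  definable_tgt : DefinableMap L A tgt
  definable_inv : DefinableMap L A inv
  definable_one : DefinableMap L A one
  definable_comp : A.Definable L
    {z : Fin n₁ ⊕ (Fin n₁ ⊕ Fin n₁) → U |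
      ∃ (g h : Arr) (e : src g = tgt h), z = Sum.elim g.1 (Sum.elim h.1 (comp g h e).1)}

end

namespace DefinableGroupoid

variable {L : FirstOrder.Language.{u, v}} {U : Type w} [L.Structure U] {A : Set U}

/-- The set of morphisms from `x` to `y`. -/
def Mor (X : DefinableGroupoid L A) (x y : X.Obj) : Set X.Arr :=
  {g | X.src g = x ∧ X.tgt g = y}

/-- The equivalence relation on objects that is the image of `(s, t) : X₁ → X₀ × X₀`. -/
def isoSetoid (X : DefinableGroupoid L A) : Setoid X.Obj where
  r x y := ∃ g : X.Arr, X.src g = x ∧ X.tgt g = y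
  iseqv :=
    { refl := fun x => ⟨X.one x, X.src_one x, X.tgt_one x⟩
      symm := fun ⟨g, h₁, h₂⟩ => ⟨X.inv g, (X.src_inv g).trans h₂, (X.tgt_inv g).trans h₁⟩
      trans := fun ⟨g, h₁, h₂⟩ ⟨k, k₁, k₂⟩ =>
        ⟨X.comp k g (k₁.trans h₂.symm), (X.src_comp _ _ _).trans h₁, (X.tgt_comp _ _ _).trans k₂⟩ }

/-- The groupoid quotient `[X]`. -/
def Quot (X : DefinableGroupoid L A) : Type w := Quotient X.isoSetoid

/-- The canonical map `X₀ → [X]`. -/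
def toQuot (X : DefinableGroupoid L A) (x : X.Obj) : X.Quot := Quotient.mk X.isoSetoid x

/-- The map `X₀ → [X]` is finite: its fibres are finite, of bounded size. (When `U` is a monster
model, finiteness of all the fibres implies the existence of a bound, by compactness.) -/
def FiniteOverQuot (X : DefinableGroupoid L A) : Prop :=
  ∃ N : ℕ, ∀ q : X.Quot, (X.toQuot ⁻¹' {q}).encard ≤ N

/-- A Morita morphism definable over `A`: a definable functor which is surjective on objects and
fully faithful. -/
structure MoritaMorphism (X Y : DefinableGroupoid L A) where
  f₀ : X.Obj → Y.Obj
  f₁ : X.Arr → Y.Arr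
  definable_f₀ : DefinableMap L A f₀
  definable_f₁ : DefinableMap L A f₁
  src_f₁ : ∀ g, Y.src (f₁ g) = f₀ (X.src g)
  tgt_f₁ : ∀ g, Y.tgt (f₁ g) = f₀ (X.tgt g)
  map_one : ∀ x, f₁ (X.one x) = Y.one (f₀ x)
  map_comp : ∀ g h e, f₁ (X.comp g h e) =
    Y.comp (f₁ g) (f₁ h) ((src_f₁ g).trans ((congrArg f₀ e).trans (tgt_f₁ h).symm))
  surjective_f₀ : Function.Surjective f₀
  bijOn_f₁ : ∀ x y, Set.BijOn f₁ (X.Mor x y) (Y.Mor (f₀ x) (f₀ y))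

/-- Morita equivalence of groupoids, through definable (over `A`) data. -/
def MoritaEquivalent (X Y : DefinableGroupoid L A) : Prop :=
  ∃ Z : DefinableGroupoid L A, Nonempty (MoritaMorphism Z X) ∧ Nonempty (MoritaMorphism Z Y)

end DefinableGroupoid

end DefGroupoid

open DefGroupoid

/-! The core is an extensional form of finite choice (`FiniteChoice`): in a family of subsets of M^n
definable over K, choose definably over K, in each nonempty member, a nonempty finite set of bounded
size that depends only on the member as a set.

On M itself, a compactness argument (`StronglyMinimal.exists_bound`) gives a bound N such that every
member of the family has at most N points or misses at most N points. Since acl(K) ∩ M is infinite,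
there is a finite K-definable F ⊆ M with more than N points. If a member meets F, its trace on F is
chosen. If not, it misses more than N points, so it has at most N points and is chosen whole
(`FiniteChoice.of_bound`). Choosing one coordinate at a time extends this to M^n
(`FiniteChoice.prod`).

Apply this to the family of isomorphism classes of X. Being extensional, the choice yields one
finite set per class; let Q be the union of these sets. The full subgroupoid Y on Q is finite over
its quotient and meets every class. A definable choice of an arrow from each object into Q may not
exist, since nothing is assumed on the arrows; hence the bridge Z has all arrows with target in Q as
its objects. Source and target are its Morita morphisms to X and Y, an arrow being its own
isomorphism between the two pullbacks (`pullbackMap`). -/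

namespace DefGroupoid

/-! ### Ultrapowers and uniform bounds in definable families -/

open Filter

theorem exists_injOn_of_lt_encard {α : Type*} {s : Set α} {N : ℕ} (h : N < s.encard) :
    ∃ f : ℕ → α, Set.InjOn f (Set.Iio N) ∧ ∀ i < N, f i ∈ s := by
  obtain ⟨t, hts, ht⟩ := Set.exists_subset_encard_eq h.le
  -- The strict inequality provides a point even when `N = 0`; it serves as the value of `f` outside
  -- the range of interest.
  obtain ⟨a, -⟩ : s.Nonempty := Set.encard_pos.1 (lt_of_le_of_lt bot_le h)
  have hfin : t.Finite := Set.finite_of_encard_eq_coe ht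
  have hcard : Nat.card t = N := by
    rw [Nat.card_coe_set_eq, Set.ncard, ht]; rfl
  have := hfin.to_subtype
  let e := (Finite.equivFinOfCardEq hcard).symm
  refine ⟨fun i => if h : i < N then (e ⟨i, h⟩ : α) else a, fun i hi k hk hik => ?_,
    fun i hi => ?_⟩
  · have hi' : i < N := hi
    have hk' : k < N := hk
    simpa [hi', hk', Subtype.coe_inj] using hik
  · simpa [hi] using hts (e ⟨i, hi⟩).2

/-- Enumerate `n` distinct points of each `S n`. The class of the sequence of `k`-th points makes
sense for `n > k`, hence almost everywhere since the ultrafilter is nonprincipal, and different `k`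
give different classes. -/
theorem infinite_ultraproduct {U : Type w} {S : ℕ → Set U} (h : ∀ n : ℕ, n < (S n).encard) :
    {x : (hyperfilter ℕ : Filter ℕ).Product (fun _ => U) |
      ∃ y : ℕ → U, x = (y : (hyperfilter ℕ : Filter ℕ).Product (fun _ => U)) ∧
        ∀ᶠ n in (hyperfilter ℕ : Filter ℕ), y n ∈ S n}.Infinite := by
  choose f hf hfS using fun n => exists_injOn_of_lt_encard (h n)
  have hlt : ∀ k : ℕ, ∀ᶠ n in (hyperfilter ℕ : Filter ℕ), k < n := fun k =>
    Nat.hyperfilter_le_atTop (eventually_gt_atTop k)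
  refine Set.infinite_of_injective_forall_mem
    (f := fun k => ((fun n => f n k : ℕ → U) : (hyperfilter ℕ : Filter ℕ).Product (fun _ => U)))
    (fun k l hkl => ?_) (fun k => ⟨_, rfl, ?_⟩)
  · have hkl' : ∀ᶠ n in (hyperfilter ℕ : Filter ℕ), f n k = f n l := Quotient.exact hkl
    obtain ⟨n, hn, hk, hl⟩ := (hkl'.and ((hlt k).and (hlt l))).exists
    exact hf n hk hl hn
  · filter_upwards [hlt k] with n hn using hfS n k hn

section

variable {L : FirstOrder.Language.{u, v}} {U : Type w} [L.Structure U]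

/-- The diagonal embedding of a structure in an ultrapower. -/
noncomputable def diagonalEmbedding [Nonempty U] {ι : Type*} (F : Ultrafilter ι) :
    U ↪ₑ[L] (F : Filter ι).Product (fun _ => U) where
  toFun x := ((fun _ => x : ι → U) : (F : Filter ι).Product (fun _ => U))
  map_formula' n φ x := by
    refine (Language.Ultraproduct.realize_formula_cast φ (fun i _ => x i)).trans ?_
    simp

/-- Strong minimality concerns elementary extensions in a larger universe; it also covers those in
the universe of `U` itself. -/
theorem StronglyMinimal.finite_or_finite_sdiff {ψ : L.Formula (U ⊕ Unit)}
    (H : ∀ (N : Type (max u v w)) [L.Structure N] (j : U ↪ₑ[L] N) (S : Set N),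
      (Set.univ : Set N).Definable₁ L S →
        (extend L j ψ ∩ S).Finite ∨ (extend L j ψ \ S).Finite)
    {N : Type w} [L.Structure N] (j : U ↪ₑ[L] N) {α : Type w} (φ : L.Formula (α ⊕ Unit))
    (v : α → N) :
    (extend L j ψ ∩ {x | φ.Realize (Sum.elim v fun _ => x)}).Finite ∨
      (extend L j ψ \ {x | φ.Realize (Sum.elim v fun _ => x)}).Finite := by
  -- The structure is copied to the larger universe, where `H` applies; `key` says that the copy
  -- satisfies the same formulas.
  let e : N ≃ ULift.{max u v w} N := Equiv.ulift.symm
  let : L.Structure (ULift.{max u v w} N) := e.inducedStructure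
  let E : N ≃[L] ULift.{max u v w} N := e.inducedStructureEquiv
  have key : ∀ {β : Type w} (χ : L.Formula (β ⊕ Unit)) (b : β → N) (x : N),
      χ.Realize (Sum.elim (fun i => E (b i)) fun _ => E x) ↔
        χ.Realize (Sum.elim b fun _ => x) := by
    intro β χ b x
    rw [← Language.StrongHomClass.realize_formula E χ]
    refine iff_of_eq (congrArg _ ?_)
    ext i
    rcases i with i | i <;> rfl
  have := H (ULift.{max u v w} N) (E.toElementaryEmbedding.comp j)
    {x | φ.Realize (Sum.elim (fun i => E (v i)) fun _ => x)} ?_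
  · have hpre := fun s : Set (ULift.{max u v w} N) =>
      fun h : s.Finite => h.preimage (f := E) E.injective.injOn
    refine this.imp (fun h => (hpre _ h).subset ?_) (fun h => (hpre _ h).subset ?_)
    · rintro x ⟨h1, h2⟩
      exact ⟨(key ψ j x).2 h1, (key φ v x).2 h2⟩
    · rintro x ⟨h1, h2⟩
      exact ⟨(key ψ j x).2 h1, fun h => h2 ((key φ v x).1 h)⟩
  · refine Set.definable_iff_exists_formula_sum.2
      ⟨φ.relabel (Sum.map (fun i => ⟨E (v i), trivial⟩) (fun _ => 0)), ?_⟩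
    ext x
    simp only [Set.mem_ofPred_eq, Language.Formula.realize_relabel]
    refine iff_of_eq (congrArg _ ?_)
    ext i
    rcases i with i | i <;> rfl

/-- In a strongly minimal set, the sets of a definable family are finite or cofinite uniformly. -/
theorem StronglyMinimal.exists_bound {M : Set U} (hM : StronglyMinimal L M) {α : Type w}
    (φ : L.Formula (α ⊕ Unit)) :
    ∃ N : ℕ, ∀ b : α → U,
      (M ∩ {x | φ.Realize (Sum.elim b fun _ => x)}).encard ≤ N ∨
        (M \ {x | φ.Realize (Sum.elim b fun _ => x)}).encard ≤ N := by
  obtain ⟨hinf, ψ, hψ, H⟩ := hM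
  -- Without a bound, some `b n` gives more than `n` points of `M` both inside and outside the set
  -- it defines. In the ultrapower, the class of the sequence `b` then defines a set that is
  -- infinite and coinfinite in the extension of `M`.
  by_contra! h
  choose b h1 h2 using h
  have : Nonempty U := ⟨hinf.nonempty.some⟩
  -- Łoś's theorem, with the parameters kept apart from the variable.
  have key : ∀ {β : Type w} (χ : L.Formula (β ⊕ Unit)) (b : ℕ → β → U) (y : ℕ → U),
      χ.Realize (Sum.elim
        (fun i => ((fun n => b n i : ℕ → U) : (hyperfilter ℕ : Filter ℕ).Product (fun _ => U)))
        (fun _ => (y : (hyperfilter ℕ : Filter ℕ).Product (fun _ => U)))) ↔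
      ∀ᶠ n in (hyperfilter ℕ : Filter ℕ), χ.Realize (Sum.elim (b n) fun _ => y n) := by
    intro β χ b y
    have := Language.Ultraproduct.realize_formula_cast (u := hyperfilter ℕ) χ
      (Sum.elim (fun i n => b n i) (fun _ => y))
    refine (iff_of_eq (congrArg _ ?_)).trans (this.trans ?_)
    · ext i
      rcases i with i | i <;> rfl
    · refine iff_of_eq (congrArg (Filter.Eventually · _) ?_)
      ext n
      refine iff_of_eq (congrArg _ ?_)
      ext i
      rcases i with i | i <;> rfl
  have keyM : ∀ y : ℕ → U,
      (y : (hyperfilter ℕ : Filter ℕ).Product (fun _ => U)) ∈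
        extend L (diagonalEmbedding (L := L) (hyperfilter ℕ)) ψ ↔
      ∀ᶠ n in (hyperfilter ℕ : Filter ℕ), y n ∈ M := by
    intro y
    rw [hψ]
    exact key ψ (fun _ => id) y
  rcases StronglyMinimal.finite_or_finite_sdiff H (diagonalEmbedding (hyperfilter ℕ)) φ
    (fun i => ((fun n => b n i : ℕ → U) : (hyperfilter ℕ : Filter ℕ).Product (fun _ => U)))
    with h | h
  · refine infinite_ultraproduct h1 (h.subset ?_)
    rintro _ ⟨y, rfl, hy⟩
    exact ⟨(keyM y).2 (hy.mono fun _ h => h.1), (key φ b y).2 (hy.mono fun _ h => h.2)⟩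
  · refine infinite_ultraproduct h2 (h.subset ?_)
    rintro _ ⟨y, rfl, hy⟩
    refine ⟨(keyM y).2 (hy.mono fun _ h => h.1), fun hφ => ?_⟩
    obtain ⟨n, hn, hn'⟩ := (hy.and ((key φ b y).1 hφ)).exists
    exact hn.2 hn'

end

/-! ### Calculus of definable types, predicates and maps -/

section

variable (L : FirstOrder.Language.{u, v}) {U : Type w} [L.Structure U] (A : Set U)

/-- A type identified with a definable set of tuples. -/
class DefSet (T : Type w) where
  Index : Type
  finite_index : Finite Index
  coord : T → Index → U
  injective_coord : Function.Injective coord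
  definable_range : A.Definable L (Set.range coord)

/-- A predicate on a definable type which is definable over `A`. -/
def DefPred {T : Type w} [DefSet L A T] (P : T → Prop) : Prop :=
  A.Definable L (DefSet.coord (L := L) (A := A) '' {t | P t})

instance {T T' : Type w} [DefSet L A T] [DefSet L A T'] : DefSet L A (T × T') where
  Index := DefSet.Index L A T ⊕ DefSet.Index L A T'
  finite_index :=
    have := DefSet.finite_index (L := L) (A := A) (T := T)
    have := DefSet.finite_index (L := L) (A := A) (T := T')
    inferInstance
  coord p := Sum.elim (DefSet.coord (L := L) (A := A) p.1) (DefSet.coord (L := L) (A := A) p.2)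
  injective_coord := by
    rintro ⟨a, b⟩ ⟨c, d⟩ h
    exact Prod.ext (DefSet.injective_coord (funext fun i => congrFun h (.inl i)))
      (DefSet.injective_coord (funext fun i => congrFun h (.inr i)))
  definable_range := by
    convert! ((DefSet.definable_range (L := L) (A := A) (T := T)).preimage_comp Sum.inl).inter
      ((DefSet.definable_range (L := L) (A := A) (T := T')).preimage_comp Sum.inr)
    ext z
    constructor
    · rintro ⟨p, rfl⟩
      exact ⟨⟨p.1, rfl⟩, ⟨p.2, rfl⟩⟩
    · rintro ⟨⟨a, ha⟩, ⟨b, hb⟩⟩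
      exact ⟨(a, b), by simp only [ha, hb]; exact Sum.elim_comp_inl_inr z⟩

/-- A map between definable types whose graph is definable over `A`. -/
def DefFun {T T' : Type w} [DefSet L A T] [DefSet L A T'] (f : T → T') : Prop :=
  DefPred L A fun p : T × T' => f p.1 = p.2

variable {L A} {T T' T'' : Type w} [DefSet L A T] [DefSet L A T'] [DefSet L A T'']

/-- When `σ` only selects and repeats coordinates, no quantifier is needed. This makes the
projections definable before substitution of general definable maps is available. -/
theorem DefPred.reindex {P : T' → Prop} (hP : DefPred L A P) (σ : T → T')
    (i : DefSet.Index L A T' → DefSet.Index L A T)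
    (h : ∀ t, DefSet.coord (L := L) (A := A) (σ t) = DefSet.coord (L := L) (A := A) t ∘ i) : DefPred L A fun t => P (σ t) := by
  unfold DefPred
  convert! (DefSet.definable_range (L := L) (A := A) (T := T)).inter (hP.preimage_comp i)
  ext z
  constructor
  · rintro ⟨t, ht, rfl⟩
    exact ⟨⟨t, rfl⟩, ⟨σ t, ht, h t⟩⟩
  · rintro ⟨⟨t, rfl⟩, ⟨s, hs, h'⟩⟩
    have : s = σ t := DefSet.injective_coord (h'.trans (h t).symm)
    subst this
    exact ⟨t, hs, rfl⟩

theorem DefPred.of_iff {P Q : T → Prop} (hP : DefPred L A P) (h : ∀ t, Q t ↔ P t) :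
    DefPred L A Q := by
  rwa [show Q = P from funext fun t => propext (h t)]

theorem DefPred.and {P Q : T → Prop} (hP : DefPred L A P) (hQ : DefPred L A Q) :
    DefPred L A fun t => P t ∧ Q t := by
  unfold DefPred
  convert! Set.Definable.inter hP hQ
  rw [← Set.image_inter DefSet.injective_coord]
  rfl

theorem DefPred.or {P Q : T → Prop} (hP : DefPred L A P) (hQ : DefPred L A Q) :
    DefPred L A fun t => P t ∨ Q t := by
  unfold DefPred
  convert! Set.Definable.union hP hQ
  rw [← Set.image_union]
  rfl

theorem DefPred.not {P : T → Prop} (hP : DefPred L A P) : DefPred L A fun t => ¬ P t := by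
  unfold DefPred
  convert! Set.Definable.sdiff (DefSet.definable_range (L := L) (A := A) (T := T)) hP
  rw [← Set.image_univ, ← Set.image_sdiff DefSet.injective_coord]
  congr 1
  ext t
  simp

theorem DefPred.exists {P : T → T' → Prop} (hP : DefPred L A fun p : T × T' => P p.1 p.2) :
    DefPred L A fun t => ∃ s, P t s := by
  have := DefSet.finite_index (L := L) (A := A) (T := T)
  have := DefSet.finite_index (L := L) (A := A) (T := T × T')
  unfold DefPred
  convert! Set.Definable.image_comp hP Sum.inl
  ext z
  constructor
  · rintro ⟨t, ⟨s, h⟩, rfl⟩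
    exact ⟨_, ⟨(t, s), h, rfl⟩, rfl⟩
  · rintro ⟨_, ⟨⟨t, s⟩, h, rfl⟩, rfl⟩
    exact ⟨t, ⟨s, h⟩, rfl⟩

theorem defPred_eq : DefPred L A fun p : T × T => p.1 = p.2 := by
  have := DefSet.finite_index (L := L) (A := A) (T := T)
  have h : ∀ i : DefSet.Index L A T, A.Definable L
      {z : DefSet.Index L A T ⊕ DefSet.Index L A T → U | z (Sum.inl i) = z (Sum.inr i)} := by
    refine fun i => ⟨(Language.Term.var (Sum.inl i)).equal (Language.Term.var (Sum.inr i)), ?_⟩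
    ext z
    simp
  unfold DefPred
  convert! (DefSet.definable_range (L := L) (A := A) (T := T × T)).inter
    (Set.definable_iInter_of_finite h)
  ext z
  constructor
  · rintro ⟨⟨t, s⟩, rfl : t = s, rfl⟩
    exact ⟨⟨_, rfl⟩, Set.mem_iInter.2 fun i => rfl⟩
  · rintro ⟨⟨⟨t, s⟩, rfl⟩, h⟩
    exact ⟨_, DefSet.injective_coord (funext fun i => Set.mem_iInter.1 h i), rfl⟩

theorem DefFun.of_reindex (σ : T → T') (i : DefSet.Index L A T' → DefSet.Index L A T)
    (h : ∀ t, DefSet.coord (L := L) (A := A) (σ t) = DefSet.coord (L := L) (A := A) t ∘ i) : DefFun L A σ :=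
  defPred_eq.reindex (fun p : T × T' => (σ p.1, p.2)) (Sum.map i id) fun p =>
    funext fun k => by
      rcases k with k | k
      · exact congrFun (h p.1) k
      · rfl

theorem defFun_id : DefFun L A (fun t : T => t) :=
  .of_reindex _ id fun _ => rfl

theorem defFun_fst : DefFun L A (fun p : T × T' => p.1) :=
  .of_reindex _ Sum.inl fun _ => rfl

theorem defFun_snd : DefFun L A (fun p : T × T' => p.2) :=
  .of_reindex _ Sum.inr fun _ => rfl

/-- The value of `f` is quantified away: `P (f t)` holds iff some `s` satisfies `f t = s ∧ P s`. -/
theorem DefPred.comp {P : T' → Prop} (hP : DefPred L A P) {f : T → T'} (hf : DefFun L A f) :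
    DefPred L A fun t => P (f t) :=
  (DefPred.exists (P := fun t s => f t = s ∧ P s)
    (hf.and (hP.reindex (fun p : T × T' => p.2) Sum.inr fun _ => rfl))).of_iff fun _ =>
      ⟨fun h => ⟨_, rfl, h⟩, fun ⟨_, h, h'⟩ => h ▸ h'⟩

theorem DefFun.prodMk {f : T → T'} {g : T → T''} (hf : DefFun L A f) (hg : DefFun L A g) :
    DefFun L A fun t => (f t, g t) :=
  ((DefPred.reindex hf (fun p : T × (T' × T'') => (p.1, p.2.1)) (Sum.map id Sum.inl)
      fun p => funext fun k => by rcases k with k | k <;> rfl).and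
    (DefPred.reindex hg (fun p : T × (T' × T'') => (p.1, p.2.2)) (Sum.map id Sum.inr)
      fun p => funext fun k => by rcases k with k | k <;> rfl)).of_iff fun _ => Prod.ext_iff

theorem DefFun.comp {g : T' → T''} (hg : DefFun L A g) {f : T → T'} (hf : DefFun L A f) :
    DefFun L A fun t => g (f t) := by
  have h : DefFun L A fun p : T × T'' => f p.1 :=
    DefPred.reindex hf (fun p : (T × T'') × T' => (p.1.1, p.2)) (Sum.map Sum.inl id)
      fun p => funext fun k => by rcases k with k | k <;> rfl
  exact DefPred.comp hg (h.prodMk defFun_snd)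

theorem DefFun.fst {f : T → T' × T''} (hf : DefFun L A f) : DefFun L A fun t => (f t).1 :=
  defFun_fst.comp hf

theorem DefFun.snd {f : T → T' × T''} (hf : DefFun L A f) : DefFun L A fun t => (f t).2 :=
  defFun_snd.comp hf

theorem DefFun.eq {f g : T → T'} (hf : DefFun L A f) (hg : DefFun L A g) :
    DefPred L A fun t => f t = g t :=
  defPred_eq.comp (hf.prodMk hg)

/-- The equation `f t = s` may be tested after applying `m`. Inverses of bijections and maps into
subtypes are handled this way. -/
theorem DefFun.of_injective_comp {m : T' → T''} (hm : DefFun L A m) (inj : Function.Injective m)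
    {f : T → T'} (h : DefFun L A fun t => m (f t)) : DefFun L A f :=
  ((h.comp defFun_fst).eq (hm.comp defFun_snd)).of_iff fun _ => inj.eq_iff.symm

theorem DefFun.symm {e : T ≃ T'} (h : DefFun L A e) : DefFun L A e.symm :=
  h.of_injective_comp e.injective (by simpa using defFun_id)

/-- The subtype of a definable predicate. -/
abbrev DefSet.subtype {P : T → Prop} (hP : DefPred L A P) : DefSet L A {t // P t} where
  Index := DefSet.Index L A T
  finite_index := DefSet.finite_index (L := L) (A := A) (T := T)
  coord t := DefSet.coord (L := L) (A := A) t.1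
  injective_coord := DefSet.injective_coord.comp Subtype.val_injective
  definable_range := by
    have h : (Set.range fun t : {t // P t} => DefSet.coord (L := L) (A := A) t.1) =
        DefSet.coord (L := L) (A := A) '' {t | P t} := by
      ext z
      simp
    exact h ▸ hP

theorem defFun_val {P : T → Prop} (hP : DefPred L A P) :
    letI := DefSet.subtype hP
    DefFun L A (Subtype.val : {t // P t} → T) :=
  letI := DefSet.subtype hP
  .of_reindex _ id fun _ => rfl

theorem DefFun.subtypeMk {P : T → Prop} (hP : DefPred L A P) {f : T' → T} (hf : DefFun L A f)
    (h : ∀ t, P (f t)) :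
    letI := DefSet.subtype hP
    DefFun L A (fun t => (⟨f t, h t⟩ : {t // P t})) :=
  letI := DefSet.subtype hP
  (defFun_val hP).of_injective_comp Subtype.val_injective hf

/-- A definable set of tuples, as a definable type. -/
abbrev DefSet.ofDefinable {α : Type} [hα : Finite α] {s : Set (α → U)} (hs : A.Definable L s) :
    DefSet L A s where
  Index := α
  finite_index := hα
  coord t := t.1
  injective_coord := Subtype.val_injective
  definable_range := by rwa [Subtype.range_coe]

theorem definableMap_iff_defFun {α β : Type} [Finite α] [Finite β] {s : Set (α → U)}
    {t : Set (β → U)} (hs : A.Definable L s) (ht : A.Definable L t) {f : s → t} :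
    letI := DefSet.ofDefinable hs
    letI := DefSet.ofDefinable ht
    DefinableMap L A f ↔ DefFun L A f := by
  refine iff_of_eq (congrArg (A.Definable L) ?_)
  ext z
  constructor
  · rintro ⟨x, rfl⟩
    exact ⟨(x, f x), rfl, rfl⟩
  · rintro ⟨⟨x, y⟩, rfl : f x = y, rfl⟩
    exact ⟨x, rfl⟩

variable (L A T) in
/-- Every definable type is in definable bijection with a set of `n`-tuples. -/
theorem DefSet.exists_equiv : ∃ (n : ℕ) (s : Set (Fin n → U)) (hs : A.Definable L s) (e : T ≃ s),
    letI := DefSet.ofDefinable hs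
    DefFun L A e := by
  have := DefSet.finite_index (L := L) (A := A) (T := T)
  obtain ⟨n, ⟨i⟩⟩ := Finite.exists_equiv_fin (DefSet.Index L A T)
  have hs := (DefSet.definable_range (L := L) (A := A) (T := T)).image_comp_equiv i.symm
  have hinj : Function.Injective fun t : T => DefSet.coord (L := L) (A := A) t ∘ i.symm := fun a b h =>
    DefSet.injective_coord (i.symm.surjective.injective_comp_right h)
  rw [← Set.range_comp] at hs
  refine ⟨n, _, hs, Equiv.ofInjective _ hinj, ?_⟩
  let := DefSet.ofDefinable hs
  exact .of_reindex _ i.symm fun _ => rfl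

end

/-! ### Extensional finite choice -/

section

variable (L : FirstOrder.Language.{u, v}) {U : Type w} [L.Structure U] (A : Set U)

/-- Uniform finite choice for definable families of subsets of `T`: from every nonempty member one
can choose definably finitely many points (a bounded number), depending only on that member as a
set. -/
def FiniteChoice (T : Type w) [DefSet L A T] : Prop :=
  ∀ (B : Type w) [DefSet L A B] (P : B → T → Prop), DefPred L A (fun p : B × T => P p.1 p.2) →
    ∃ Q : B → T → Prop, DefPred L A (fun p : B × T => Q p.1 p.2) ∧ (∀ b t, Q b t → P b t) ∧
      (∀ b, (∃ t, P b t) → ∃ t, Q b t) ∧ (∃ N : ℕ, ∀ b, {t | Q b t}.encard ≤ N) ∧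
      ∀ b b', P b = P b' → Q b = Q b'

variable {L A} {T T' : Type w} [DefSet L A T] [DefSet L A T']

theorem FiniteChoice.of_subsingleton [Subsingleton T] : FiniteChoice L A T := fun B _ P hP =>
  ⟨P, hP, fun _ _ h => h, fun _ h => h, ⟨1, fun b => by
    simpa using Set.encard_le_one_iff_subsingleton.2 Set.subsingleton_of_subsingleton⟩,
    fun _ _ h => h⟩

theorem FiniteChoice.of_injective {f : T → T'} (hf : DefFun L A f) (inj : Function.Injective f)
    (h : FiniteChoice L A T') : FiniteChoice L A T := by
  intro B _ P hP
  obtain ⟨Q, hQ, hQP, hne, ⟨N, hN⟩, hext⟩ := h B (fun b s => ∃ t, f t = s ∧ P b t)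
    (DefPred.exists (P := fun (p : B × T') t => f t = p.2 ∧ P p.1 t)
      (((hf.comp defFun_snd).eq defFun_fst.snd).and (hP.comp (defFun_fst.fst.prodMk defFun_snd))))
  refine ⟨fun b t => Q b (f t), hQ.comp (defFun_fst.prodMk (hf.comp defFun_snd)),
    fun b t ht => ?_, fun b ⟨t, ht⟩ => ?_, ⟨N, fun b => ?_⟩, fun b b' hb => ?_⟩
  · obtain ⟨t', h, h'⟩ := hQP _ _ ht
    exact inj h ▸ h'
  · obtain ⟨s, hs⟩ := hne b ⟨_, t, rfl, ht⟩
    obtain ⟨t', rfl, -⟩ := hQP _ _ hs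
    exact ⟨t', hs⟩
  · rw [← inj.encard_image]
    exact (Set.encard_le_encard (Set.image_subset_iff.2 fun t ht => ht)).trans (hN b)
  · have := hext b b' (by simp only [hb])
    simp only [this]

theorem encard_le_mul_of_fst {α β : Type*} {s : Set (α × β)} {I : Set α} {m n : ℕ}
    (hI : I.encard ≤ m) (hs : ∀ p ∈ s, p.1 ∈ I) (hn : ∀ a, {b | (a, b) ∈ s}.encard ≤ n) :
    s.encard ≤ (m * n : ℕ) := by
  have hfin : I.Finite := Set.finite_of_encard_le_coe hI
  have key : ∀ J : Finset α, {p ∈ s | p.1 ∈ J}.encard ≤ (J.card * n : ℕ) := by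
    classical
    intro J
    induction J using Finset.induction_on with
    | empty => simp
    | insert a J ha ih =>
      have : {p ∈ s | p.1 ∈ insert a J} ⊆
          {p ∈ s | p.1 ∈ J} ∪ Prod.mk a '' {b | (a, b) ∈ s} := by
        rintro ⟨x, y⟩ ⟨h, h'⟩
        rcases Finset.mem_insert.1 h' with rfl | h'
        · exact .inr ⟨y, h, rfl⟩
        · exact .inl ⟨h, h'⟩
      refine (Set.encard_le_encard this).trans ((Set.encard_union_le _ _).trans
        ((add_le_add ih ((Set.encard_image_le _ _).trans (hn a))).trans ?_))
      rw [Finset.card_insert_of_notMem ha, add_mul, one_mul]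
      exact_mod_cast le_rfl
  have hsub : s ⊆ {p ∈ s | p.1 ∈ hfin.toFinset} := fun p hp =>
    ⟨hp, hfin.mem_toFinset.2 (hs p hp)⟩
  refine (Set.encard_le_encard hsub).trans ((key hfin.toFinset).trans ?_)
  rw [hfin.encard_eq_coe_toFinset_card] at hI
  exact_mod_cast Nat.mul_le_mul_right n (by exact_mod_cast hI)

/-- Choose first coordinates in the projection of `P b`, then second coordinates in the fibres over
them. Projection and fibres depend only on the set `P b`, so the choice remains extensional, and the
bounds multiply. -/
theorem FiniteChoice.prod (h : FiniteChoice L A T) (h' : FiniteChoice L A T') :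
    FiniteChoice L A (T × T') := by
  intro B _ P hP
  have hP' : DefPred L A fun p : (B × T) × T' => P p.1.1 (p.1.2, p.2) :=
    hP.comp (defFun_fst.fst.prodMk (defFun_fst.snd.prodMk defFun_snd))
  obtain ⟨Q₁, hQ₁, hQP₁, hne₁, ⟨N₁, hN₁⟩, hext₁⟩ := h B (fun b t => ∃ s, P b (t, s))
    (DefPred.exists (P := fun (p : B × T) s => P p.1 (p.2, s)) hP')
  obtain ⟨Q₂, hQ₂, hQP₂, hne₂, ⟨N₂, hN₂⟩, hext₂⟩ := h' (B × T) (fun p s => P p.1 (p.2, s)) hP'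
  refine ⟨fun b t => Q₁ b t.1 ∧ Q₂ (b, t.1) t.2,
    (hQ₁.comp (defFun_fst.prodMk defFun_snd.fst)).and
      (hQ₂.comp ((defFun_fst.prodMk defFun_snd.fst).prodMk defFun_snd.snd)),
    fun b t ht => hQP₂ _ _ ht.2, fun b ⟨t, ht⟩ => ?_, ⟨N₁ * N₂, fun b => ?_⟩, fun b b' hb => ?_⟩
  · obtain ⟨t₁, ht₁⟩ := hne₁ b ⟨t.1, t.2, ht⟩
    obtain ⟨t₂, ht₂⟩ := hne₂ (b, t₁) (hQP₁ _ _ ht₁)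
    exact ⟨(t₁, t₂), ht₁, ht₂⟩
  · exact encard_le_mul_of_fst (hN₁ b) (fun p hp => hp.1) fun a =>
      (Set.encard_le_encard fun s hs => hs.2).trans (hN₂ (b, a))
  · have e₁ := hext₁ b b' (by simp only [hb])
    have e₂ := fun a => hext₂ (b, a) (b', a) (by simp only [hb])
    simp only [e₁, e₂]

/-- Take `P b ∩ F` when it is nonempty and all of `P b` otherwise. In the second case the complement
contains `F`, which has more than `N` points, so the first alternative of the bound must hold. -/
theorem FiniteChoice.of_bound
    (h₁ : ∀ (B : Type w) [DefSet L A B] (P : B → T → Prop),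
      DefPred L A (fun p : B × T => P p.1 p.2) →
        ∃ N : ℕ, ∀ b, {t | P b t}.encard ≤ N ∨ {t | ¬ P b t}.encard ≤ N)
    (h₂ : ∀ N : ℕ, ∃ F : Set T, DefPred L A (· ∈ F) ∧ F.Finite ∧ N < F.encard) :
    FiniteChoice L A T := by
  intro B _ P hP
  obtain ⟨N, hN⟩ := h₁ B P hP
  obtain ⟨F, hF, hfin, hNF⟩ := h₂ N
  refine ⟨fun b t => P b t ∧ (t ∈ F ∨ ¬ ∃ s, s ∈ F ∧ P b s),
    hP.and ((hF.comp defFun_snd).or (DefPred.not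
      (DefPred.exists (P := fun (p : B × T) s => s ∈ F ∧ P p.1 s)
        ((hF.comp defFun_snd).and (hP.comp (defFun_fst.fst.prodMk defFun_snd)))))),
    fun b t h => h.1, fun b ⟨t, ht⟩ => ?_, ⟨F.ncard + N, fun b => ?_⟩, fun b b' hb => ?_⟩
  · by_cases h : ∃ s, s ∈ F ∧ P b s
    · obtain ⟨s, hs, hs'⟩ := h
      exact ⟨s, hs', .inl hs⟩
    · exact ⟨t, ht, .inr h⟩
  · push_cast
    rw [hfin.cast_ncard_eq]
    by_cases h : ∃ s, s ∈ F ∧ P b s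
    · exact (Set.encard_le_encard fun t ht => ht.2.resolve_right (not_not.2 h)).trans
        le_self_add
    · refine le_trans (Set.encard_le_encard fun t ht => ht.1) (le_trans ?_ le_add_self)
      refine (hN b).resolve_right fun h' => ?_
      refine absurd (hNF.trans_le (Set.encard_le_encard fun t ht => ?_)) h'.not_gt
      exact fun h'' => h ⟨t, ht, h''⟩
  · simp only [hb]

/-- A definable subset of `U`, as a definable type. -/
abbrev DefSet.ofDefinable₁ {s : Set U} (hs : A.Definable₁ L s) : DefSet L A s where
  Index := Fin 1
  finite_index := inferInstance
  coord t := fun _ => t.1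
  injective_coord := fun a b h => Subtype.ext (congrFun h 0)
  definable_range := by
    have h : (Set.range fun (t : s) (_ : Fin 1) => t.1) = {x : Fin 1 → U | x 0 ∈ s} := by
      ext z
      constructor
      · rintro ⟨t, rfl⟩
        exact t.2
      · exact fun h => ⟨⟨z 0, h⟩, funext fun i => congrArg z (Subsingleton.elim _ _)⟩
    exact h ▸ hs

/-- Take `N + 1` algebraic points of `M`, unite finite definable sets containing them, and cut the
union down to `M`. -/
theorem exists_definable_finite_of_infinite_acl {M : Set U} (hM : A.Definable₁ L M)
    (h : (acl L A ∩ M).Infinite) (N : ℕ) :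
    ∃ F ⊆ M, A.Definable₁ L F ∧ F.Finite ∧ N < F.encard := by
  obtain ⟨t, hts, ht⟩ := h.exists_subset_card_eq (N + 1)
  choose! S hS hSfin hmem using fun a (ha : a ∈ acl L A) => ha
  refine ⟨M ∩ ⋃ a ∈ t, S a, Set.inter_subset_left, ?_,
    (t.finite_toSet.biUnion fun a ha => hSfin a (hts ha).1).inter_of_right M, ?_⟩
  · have : A.Definable L (⋃ a : t, {x : Fin 1 → U | x 0 ∈ S a}) :=
      Set.definable_iUnion_of_finite fun a => hS a (hts a.2).1
    unfold Set.Definable₁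
    convert! Set.Definable.inter hM this
    ext x
    simp
  · have : (t : Set U) ⊆ M ∩ ⋃ a ∈ t, S a := fun a ha =>
      ⟨(hts ha).2, Set.mem_biUnion ha (hmem a (hts ha).1)⟩
    refine lt_of_lt_of_le ?_ (Set.encard_le_encard this)
    rw [Set.encard_coe_eq_coe_finsetCard, ht]
    exact_mod_cast Nat.lt_succ_self N

theorem StronglyMinimal.finiteChoice {M : Set U} (hM : StronglyMinimal L M)
    (hMA : A.Definable₁ L M) (hacl : (acl L A ∩ M).Infinite) :
    letI := DefSet.ofDefinable₁ hMA
    FiniteChoice L A M := by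
  let := DefSet.ofDefinable₁ hMA
  refine FiniteChoice.of_bound (fun B _ P hP => ?_) fun N => ?_
  · obtain ⟨φ, hφ⟩ := Set.definable_iff_exists_formula_sum.1 hP
    have key : ∀ b (m : M), P b m ↔ φ.Realize
        (Sum.elim (fun a : A => (a : U)) (Sum.elim (DefSet.coord (L := L) (A := A) b)
          fun _ : Fin 1 => (m : U))) := by
      intro b m
      rw [← Set.mem_ofPred_eq (p := fun z => φ.Realize (Sum.elim (fun a : A => (a : U)) z))]
      rw [← hφ]
      constructor
      · exact fun h => ⟨(b, m), h, rfl⟩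
      · rintro ⟨q, hq, h⟩
        have : q = (b, m) := DefSet.injective_coord h
        subst this
        exact hq
    -- The elements of `A` and the coordinates of `b` together become the parameters, leaving the
    -- point of `M` as the only variable; hence `N` does not depend on `b`.
    obtain ⟨N, hN⟩ := hM.exists_bound (φ.relabel (Sum.elim (fun a => Sum.inl (Sum.inl a))
      (Sum.elim (fun i => Sum.inl (Sum.inr i)) fun _ => Sum.inr ())))
    have key' : ∀ b (m : M), P b m ↔ (φ.relabel (Sum.elim (fun a => Sum.inl (Sum.inl a))
        (Sum.elim (fun i => Sum.inl (Sum.inr i)) fun _ => Sum.inr ()))).Realize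
          (Sum.elim (Sum.elim (fun a : A => (a : U)) (DefSet.coord (L := L) (A := A) b))
            fun _ : Unit => (m : U)) := by
      intro b m
      rw [key, Language.Formula.realize_relabel]
      refine iff_of_eq (congrArg _ (funext fun i => ?_))
      rcases i with i | i | i <;> rfl
    refine ⟨N, fun b => ?_⟩
    refine (hN (Sum.elim (fun a : A => (a : U)) (DefSet.coord (L := L) (A := A) b))).imp
      (fun h => ?_) fun h => ?_
    · refine le_trans ?_ h
      rw [← Subtype.val_injective.encard_image]
      refine Set.encard_le_encard ?_
      rintro _ ⟨m, hm, rfl⟩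
      exact ⟨m.2, (key' b m).1 hm⟩
    · refine le_trans ?_ h
      rw [← Subtype.val_injective.encard_image]
      refine Set.encard_le_encard ?_
      rintro _ ⟨m, hm, rfl⟩
      exact ⟨m.2, fun h => hm ((key' b m).2 h)⟩
  · obtain ⟨F, hFM, hF, hfin, hN⟩ := exists_definable_finite_of_infinite_acl hMA hacl N
    have himg : (Subtype.val '' {m : M | (m : U) ∈ F}) = F := by
      ext x
      exact ⟨fun ⟨m, hm, h⟩ => h ▸ hm, fun hx => ⟨⟨x, hFM hx⟩, hx, rfl⟩⟩
    refine ⟨{m | (m : U) ∈ F}, ?_, hfin.preimage Subtype.val_injective.injOn, ?_⟩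
    · unfold DefPred
      unfold Set.Definable₁ at hF
      convert! hF
      ext z
      constructor
      · rintro ⟨m, hm, rfl⟩
        exact hm
      · exact fun hz => ⟨⟨z (0 : Fin 1), hFM hz⟩, hz,
          funext fun i => congrArg z (Subsingleton.elim (α := Fin 1) _ _)⟩
    · rwa [← Subtype.val_injective.encard_image, himg]

theorem FiniteChoice.of_subset_pow {M : Set U} (hM : A.Definable₁ L M)
    (h : letI := DefSet.ofDefinable₁ hM; FiniteChoice L A M) :
    ∀ (n : ℕ) (s : Set (Fin n → U)) (hs : A.Definable L s), (∀ x ∈ s, ∀ i, x i ∈ M) →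
      letI := DefSet.ofDefinable hs
      FiniteChoice L A s := by
  intro n
  induction n with
  | zero =>
    intro s hs _
    let := DefSet.ofDefinable hs
    exact .of_subsingleton
  | succ n ih =>
    intro s hs hsM
    have hpow : A.Definable L {x : Fin n → U | ∀ i, x i ∈ M} := by
      have : A.Definable L (⋂ i, {x : Fin n → U | x i ∈ M}) :=
        Set.definable_iInter_of_finite fun i => hM.preimage_comp fun _ => i
      convert! this
      ext x
      simp
    let := DefSet.ofDefinable hs
    let := DefSet.ofDefinable hpow
    let := DefSet.ofDefinable₁ hM
    -- Splitting off the last coordinate embeds `s` in the product of the full power of `M` and `M`.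
    refine FiniteChoice.of_injective
      (f := fun x : s => ((⟨fun i => x.1 i.castSucc, fun i => hsM _ x.2 _⟩, ⟨x.1 (Fin.last n),
        hsM _ x.2 _⟩) : {x : Fin n → U | ∀ i, x i ∈ M} × M))
      (DefFun.of_reindex _ (Sum.elim Fin.castSucc fun _ => Fin.last n) fun x => ?_)
      (fun x y hxy => ?_) ((ih _ hpow fun x hx => hx).prod h)
    · funext k
      rcases k with k | k <;> rfl
    · obtain ⟨h1, h2⟩ := Prod.ext_iff.1 hxy
      refine Subtype.ext (funext fun i => ?_)
      induction i using Fin.lastCases with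
      | last => exact congrArg Subtype.val h2
      | cast i => exact congrFun (congrArg Subtype.val h1) i

end

/-! ### Groupoids on definable types and their pullbacks -/

section

variable (L : FirstOrder.Language.{u, v}) {U : Type w} [L.Structure U] (A : Set U)

/-- A groupoid structure on definable types of objects and arrows, with definable structure maps. -/
structure GroupoidOn (O R : Type w) [DefSet L A O] [DefSet L A R] where
  src : R → O
  tgt : R → O
  comp : (g h : R) → src g = tgt h → R
  inv : R → R
  one : O → R
  src_comp : ∀ g h e, src (comp g h e) = src h
  tgt_comp : ∀ g h e, tgt (comp g h e) = tgt g
  src_one : ∀ x, src (one x) = x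
  tgt_one : ∀ x, tgt (one x) = x
  src_inv : ∀ g, src (inv g) = tgt g
  tgt_inv : ∀ g, tgt (inv g) = src g
  comp_assoc : ∀ g h k (e : src g = tgt h) (e' : src h = tgt k),
    comp (comp g h e) k ((src_comp g h e).trans e') =
      comp g (comp h k e') (e.trans (tgt_comp h k e').symm)
  one_comp : ∀ g, comp (one (tgt g)) g (src_one _) = g
  comp_one : ∀ g, comp g (one (src g)) (tgt_one _).symm = g
  inv_comp : ∀ g, comp (inv g) g (src_inv g) = one (src g)
  comp_inv : ∀ g, comp g (inv g) (tgt_inv g).symm = one (tgt g)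
  defFun_src : DefFun L A src
  defFun_tgt : DefFun L A tgt
  defFun_inv : DefFun L A inv
  defFun_one : DefFun L A one
  defPred_comp : DefPred L A fun p : R × R × R => ∃ e : src p.1 = tgt p.2.1, comp p.1 p.2.1 e = p.2.2

variable {L A}

/-- Transport of a groupoid structure along definable bijections to sets of tuples. -/
def GroupoidOn.transport {O R : Type w} [DefSet L A O] [DefSet L A R] (G : GroupoidOn L A O R)
    {m n : ℕ} {s : Set (Fin m → U)} {t : Set (Fin n → U)} (hs : A.Definable L s)
    (ht : A.Definable L t) (e : O ≃ s) (e' : R ≃ t)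
    (he : letI := DefSet.ofDefinable hs; DefFun L A e)
    (he' : letI := DefSet.ofDefinable ht; DefFun L A e') : DefinableGroupoid L A where
  n₀ := m
  n₁ := n
  Obj := s
  Arr := t
  src g := e (G.src (e'.symm g))
  tgt g := e (G.tgt (e'.symm g))
  comp g h eq := e' (G.comp (e'.symm g) (e'.symm h) (e.injective eq))
  inv g := e' (G.inv (e'.symm g))
  one x := e' (G.one (e.symm x))
  src_comp g h eq := by simp [G.src_comp]
  tgt_comp g h eq := by simp [G.tgt_comp]
  src_one x := by simp [G.src_one]
  tgt_one x := by simp [G.tgt_one]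
  src_inv x := by simp [G.src_inv]
  tgt_inv x := by simp [G.tgt_inv]
  comp_assoc g h k eq eq' := by
    simpa using G.comp_assoc (e'.symm g) (e'.symm h) (e'.symm k) (e.injective eq) (e.injective eq')
  one_comp g := e'.symm.injective (by simpa using G.one_comp (e'.symm g))
  comp_one g := e'.symm.injective (by simpa using G.comp_one (e'.symm g))
  inv_comp g := by simpa using G.inv_comp (e'.symm g)
  comp_inv g := by simpa using G.comp_inv (e'.symm g)
  definable_Obj := hs
  definable_Arr := ht
  definable_src :=
    letI := DefSet.ofDefinable hs
    letI := DefSet.ofDefinable ht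
    (definableMap_iff_defFun ht hs).2 (he.comp (G.defFun_src.comp he'.symm))
  definable_tgt :=
    letI := DefSet.ofDefinable hs
    letI := DefSet.ofDefinable ht
    (definableMap_iff_defFun ht hs).2 (he.comp (G.defFun_tgt.comp he'.symm))
  definable_inv :=
    letI := DefSet.ofDefinable hs
    letI := DefSet.ofDefinable ht
    (definableMap_iff_defFun ht ht).2 (he'.comp (G.defFun_inv.comp he'.symm))
  definable_one :=
    letI := DefSet.ofDefinable hs
    letI := DefSet.ofDefinable ht
    (definableMap_iff_defFun hs ht).2 (he'.comp (G.defFun_one.comp he.symm))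
  definable_comp := by
    let := DefSet.ofDefinable hs
    let := DefSet.ofDefinable ht
    have h : DefPred L A fun p : t × t × t =>
        ∃ eq : G.src (e'.symm p.1) = G.tgt (e'.symm p.2.1),
          G.comp (e'.symm p.1) (e'.symm p.2.1) eq = e'.symm p.2.2 :=
      G.defPred_comp.comp ((he'.symm.comp defFun_fst).prodMk
        ((he'.symm.comp defFun_snd.fst).prodMk (he'.symm.comp defFun_snd.snd)))
    unfold DefPred at h
    convert! h
    ext z
    constructor
    · rintro ⟨g, h, eq, rfl⟩
      exact ⟨(g, h, _), ⟨e.injective eq, (e'.symm_apply_apply _).symm⟩, rfl⟩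
    · rintro ⟨⟨g, h, k⟩, ⟨eq, hk⟩, rfl⟩
      have hk' : k = _ := ((Equiv.eq_symm_apply e').1 hk).symm
      exact ⟨g, h, congrArg e eq, congrArg (fun k : t => Sum.elim g.1 (Sum.elim h.1 k.1)) hk'⟩

namespace DefinableGroupoid

instance (X : DefinableGroupoid L A) : DefSet L A X.Obj := DefSet.ofDefinable X.definable_Obj

instance (X : DefinableGroupoid L A) : DefSet L A X.Arr := DefSet.ofDefinable X.definable_Arr

theorem defFun_src (X : DefinableGroupoid L A) : DefFun L A X.src :=
  (definableMap_iff_defFun X.definable_Arr X.definable_Obj).1 X.definable_src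

theorem defFun_tgt (X : DefinableGroupoid L A) : DefFun L A X.tgt :=
  (definableMap_iff_defFun X.definable_Arr X.definable_Obj).1 X.definable_tgt

theorem defFun_inv (X : DefinableGroupoid L A) : DefFun L A X.inv :=
  (definableMap_iff_defFun X.definable_Arr X.definable_Arr).1 X.definable_inv

theorem defFun_one (X : DefinableGroupoid L A) : DefFun L A X.one :=
  (definableMap_iff_defFun X.definable_Obj X.definable_Arr).1 X.definable_one

theorem defPred_comp (X : DefinableGroupoid L A) : DefPred L A fun p : X.Arr × X.Arr × X.Arr =>
    ∃ e : X.src p.1 = X.tgt p.2.1, X.comp p.1 p.2.1 e = p.2.2 := by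
  have h := X.definable_comp
  unfold DefPred
  convert! h
  ext z
  constructor
  · rintro ⟨⟨g, h, k⟩, ⟨e, hk⟩, rfl⟩
    exact ⟨g, h, e, congrArg (fun k : X.Arr => Sum.elim g.1 (Sum.elim h.1 k.1)) hk.symm⟩
  · rintro ⟨g, h, e, rfl⟩
    exact ⟨(g, h, _), ⟨e, rfl⟩, rfl⟩

/-- Composition carries a proof of composability, which obstructs rewriting its arrows directly. -/
theorem comp_congr (X : DefinableGroupoid L A) {g g' h h' : X.Arr} (hg : g = g') (hh : h = h')
    (e : X.src g = X.tgt h) : X.comp g h e = X.comp g' h' (hg ▸ hh ▸ e) := by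
  subst hg hh
  rfl

theorem defFun_comp (X : DefinableGroupoid L A) {T : Type w} [DefSet L A T] {f g : T → X.Arr}
    (hf : DefFun L A f) (hg : DefFun L A g) (e : ∀ t, X.src (f t) = X.tgt (g t)) :
    DefFun L A fun t => X.comp (f t) (g t) (e t) :=
  DefPred.of_iff (X.defPred_comp.comp
    ((hf.comp defFun_fst).prodMk ((hg.comp defFun_fst).prodMk defFun_snd)))
    fun p => ⟨fun h => ⟨e p.1, h⟩, fun ⟨_, h⟩ => h⟩

section Pullback

variable (X : DefinableGroupoid L A) {P : Type w} [DefSet L A P] (f : P → X.Obj)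

/-- The arrows of the pullback of a groupoid along a map to its objects. -/
abbrev PullbackArr : Type w :=
  {t : (P × P) × X.Arr // X.src t.2 = f t.1.1 ∧ X.tgt t.2 = f t.1.2}

variable {f}

theorem defPred_pullbackArr (hf : DefFun L A f) : DefPred L A
    fun t : (P × P) × X.Arr => X.src t.2 = f t.1.1 ∧ X.tgt t.2 = f t.1.2 :=
  ((X.defFun_src.comp defFun_snd).eq (hf.comp defFun_fst.fst)).and
    ((X.defFun_tgt.comp defFun_snd).eq (hf.comp defFun_fst.snd))

/-- The pullback of a groupoid along a definable map to its objects. -/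
def pullbackOn (hf : DefFun L A f) :
    letI := DefSet.subtype (X.defPred_pullbackArr hf)
    GroupoidOn L A P (X.PullbackArr f) :=
  letI := DefSet.subtype (X.defPred_pullbackArr hf)
  have hval := defFun_val (X.defPred_pullbackArr hf)
  { src := fun t => t.1.1.1
    tgt := fun t => t.1.1.2
    comp := fun g h e => ⟨((h.1.1.1, g.1.1.2),
        X.comp g.1.2 h.1.2 (g.2.1.trans ((congrArg f e).trans h.2.2.symm))),
      (X.src_comp _ _ _).trans h.2.1, (X.tgt_comp _ _ _).trans g.2.2⟩
    inv := fun g => ⟨((g.1.1.2, g.1.1.1), X.inv g.1.2),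
      (X.src_inv _).trans g.2.2, (X.tgt_inv _).trans g.2.1⟩
    one := fun p => ⟨((p, p), X.one (f p)), X.src_one _, X.tgt_one _⟩
    src_comp := fun _ _ _ => rfl
    tgt_comp := fun _ _ _ => rfl
    src_one := fun _ => rfl
    tgt_one := fun _ => rfl
    src_inv := fun _ => rfl
    tgt_inv := fun _ => rfl
    comp_assoc := fun g h k e e' => Subtype.ext (Prod.ext rfl (X.comp_assoc _ _ _ _ _))
    one_comp := fun g => Subtype.ext (Prod.ext rfl
      ((X.comp_congr (congrArg X.one g.2.2.symm) rfl _).trans (X.one_comp _)))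
    comp_one := fun g => Subtype.ext (Prod.ext rfl
      ((X.comp_congr rfl (congrArg X.one g.2.1.symm) _).trans (X.comp_one _)))
    inv_comp := fun g => Subtype.ext (Prod.ext rfl
      ((X.inv_comp _).trans (congrArg X.one g.2.1)))
    comp_inv := fun g => Subtype.ext (Prod.ext rfl
      ((X.comp_inv _).trans (congrArg X.one g.2.2)))
    defFun_src := hval.fst.fst
    defFun_tgt := hval.fst.snd
    defFun_inv := DefFun.subtypeMk _
      ((hval.fst.snd.prodMk hval.fst.fst).prodMk (X.defFun_inv.comp hval.snd)) _
    defFun_one := DefFun.subtypeMk _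
      ((defFun_id.prodMk defFun_id).prodMk (X.defFun_one.comp hf)) _
    defPred_comp := by
      have h1 := hval.comp (defFun_fst (L := L) (A := A) (T := X.PullbackArr f)
        (T' := X.PullbackArr f × X.PullbackArr f))
      have h2 := hval.comp (defFun_snd (L := L) (A := A) (T := X.PullbackArr f)
        (T' := X.PullbackArr f × X.PullbackArr f)).fst
      have h3 := hval.comp (defFun_snd (L := L) (A := A) (T := X.PullbackArr f)
        (T' := X.PullbackArr f × X.PullbackArr f)).snd
      refine DefPred.of_iff (((h1.fst.fst.eq h2.fst.snd).and
        ((h2.fst.fst.prodMk h1.fst.snd).eq h3.fst)).and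
          (X.defPred_comp.comp (h1.snd.prodMk (h2.snd.prodMk h3.snd)))) ?_
      rintro ⟨g, h, k⟩
      constructor
      · rintro ⟨e, hk⟩
        exact ⟨⟨e, congrArg (fun k => k.1.1) hk⟩, ⟨_, congrArg (fun k => k.1.2) hk⟩⟩
      · rintro ⟨⟨e, e'⟩, ⟨_, h⟩⟩
        exact ⟨e, Subtype.ext (Prod.ext e' h)⟩ }

end Pullback

end DefinableGroupoid

end

/-! ### Morita maps, conjugation, and the finite model of a groupoid -/

section

variable {L : FirstOrder.Language.{u, v}} {U : Type w} [L.Structure U] {A : Set U}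

/-- A definable groupoid definably isomorphic to a given groupoid on definable types. -/
structure GroupoidOn.Realization {O R : Type w} [DefSet L A O] [DefSet L A R]
    (G : GroupoidOn L A O R) where
  gpd : DefinableGroupoid L A
  obj : O ≃ gpd.Obj
  arr : R ≃ gpd.Arr
  defFun_obj : DefFun L A obj
  defFun_arr : DefFun L A arr
  src_arr : ∀ g, gpd.src (arr g) = obj (G.src g)
  tgt_arr : ∀ g, gpd.tgt (arr g) = obj (G.tgt g)
  one_obj : ∀ x, gpd.one (obj x) = arr (G.one x)
  comp_arr : ∀ g h (e : G.src g = G.tgt h) (e' : gpd.src (arr g) = gpd.tgt (arr h)),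
    gpd.comp (arr g) (arr h) e' = arr (G.comp g h e)

theorem GroupoidOn.nonempty_realization {O R : Type w} [DefSet L A O] [DefSet L A R]
    (G : GroupoidOn L A O R) : Nonempty G.Realization := by
  obtain ⟨m, s, hs, e, he⟩ := DefSet.exists_equiv L A O
  obtain ⟨n, t, ht, e', he'⟩ := DefSet.exists_equiv L A R
  refine ⟨⟨G.transport hs ht e e' he he', e, e', he, he', fun g => ?_, fun g => ?_, fun g => ?_,
    fun g h eq eq' => ?_⟩⟩
  · exact congrArg (fun g => e (G.src g)) (e'.symm_apply_apply g)
  · exact congrArg (fun g => e (G.tgt g)) (e'.symm_apply_apply g)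
  · exact congrArg (fun g => e' (G.one g)) (e.symm_apply_apply g)
  · change e' (G.comp (e'.symm (e' g)) (e'.symm (e' h)) _) = _
    simp only [Equiv.symm_apply_apply]
    rfl

/-- A definable fully faithful functor, surjective on objects, between groupoids on definable
types. -/
structure GroupoidOn.MoritaMap {O R O' R' : Type w} [DefSet L A O] [DefSet L A R] [DefSet L A O']
    [DefSet L A R'] (G : GroupoidOn L A O R) (H : GroupoidOn L A O' R') where
  obj : O → O'
  arr : R → R'
  defFun_obj : DefFun L A obj
  defFun_arr : DefFun L A arr
  src_arr : ∀ g, H.src (arr g) = obj (G.src g)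
  tgt_arr : ∀ g, H.tgt (arr g) = obj (G.tgt g)
  arr_one : ∀ x, arr (G.one x) = H.one (obj x)
  arr_comp : ∀ g h e e', arr (G.comp g h e) = H.comp (arr g) (arr h) e'
  surjective_obj : Function.Surjective obj
  faithful : ∀ g g', G.src g = G.src g' → G.tgt g = G.tgt g' → arr g = arr g' → g = g'
  full : ∀ x y h, H.src h = obj x → H.tgt h = obj y → ∃ g, G.src g = x ∧ G.tgt g = y ∧ arr g = h

/-- Transport of a Morita map to realizations. -/
def GroupoidOn.MoritaMap.toMoritaMorphism {O R O' R' : Type w} [DefSet L A O] [DefSet L A R]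
    [DefSet L A O'] [DefSet L A R'] {G : GroupoidOn L A O R} {H : GroupoidOn L A O' R'}
    (F : G.MoritaMap H) (r : G.Realization) (r' : H.Realization) :
    DefinableGroupoid.MoritaMorphism r.gpd r'.gpd where
  f₀ x := r'.obj (F.obj (r.obj.symm x))
  f₁ g := r'.arr (F.arr (r.arr.symm g))
  definable_f₀ := (definableMap_iff_defFun r.gpd.definable_Obj r'.gpd.definable_Obj).2
    (r'.defFun_obj.comp (F.defFun_obj.comp r.defFun_obj.symm))
  definable_f₁ := (definableMap_iff_defFun r.gpd.definable_Arr r'.gpd.definable_Arr).2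
    (r'.defFun_arr.comp (F.defFun_arr.comp r.defFun_arr.symm))
  src_f₁ g := by
    obtain ⟨g, rfl⟩ := r.arr.surjective g
    simp [r.src_arr, r'.src_arr, F.src_arr]
  tgt_f₁ g := by
    obtain ⟨g, rfl⟩ := r.arr.surjective g
    simp [r.tgt_arr, r'.tgt_arr, F.tgt_arr]
  map_one x := by
    obtain ⟨x, rfl⟩ := r.obj.surjective x
    simp [r.one_obj, r'.one_obj, F.arr_one]
  map_comp g h e := by
    obtain ⟨g, rfl⟩ := r.arr.surjective g
    obtain ⟨h, rfl⟩ := r.arr.surjective h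
    have e₁ : G.src g = G.tgt h := r.obj.injective (by rwa [← r.src_arr, ← r.tgt_arr])
    have e₂ : H.src (F.arr g) = H.tgt (F.arr h) := by rw [F.src_arr, F.tgt_arr, e₁]
    rw [r.comp_arr g h e₁ e, r'.gpd.comp_congr (congrArg (fun g => r'.arr (F.arr g))
      (r.arr.symm_apply_apply g)) (congrArg (fun g => r'.arr (F.arr g))
      (r.arr.symm_apply_apply h)), r'.comp_arr _ _ e₂, r.arr.symm_apply_apply,
      F.arr_comp g h e₁ e₂]
  surjective_f₀ := r'.obj.surjective.comp (F.surjective_obj.comp r.obj.symm.surjective)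
  bijOn_f₁ x y := by
    obtain ⟨x, rfl⟩ := r.obj.surjective x
    obtain ⟨y, rfl⟩ := r.obj.surjective y
    refine ⟨fun g hg => ?_, fun g hg g' hg' h => ?_, fun h hh => ?_⟩
    · obtain ⟨g, rfl⟩ := r.arr.surjective g
      obtain ⟨h1, h2⟩ := hg
      rw [r.src_arr, r.obj.apply_eq_iff_eq] at h1
      rw [r.tgt_arr, r.obj.apply_eq_iff_eq] at h2
      simp [DefinableGroupoid.Mor, r'.src_arr, r'.tgt_arr, F.src_arr, F.tgt_arr, h1, h2]
    · obtain ⟨g, rfl⟩ := r.arr.surjective g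
      obtain ⟨g', rfl⟩ := r.arr.surjective g'
      have h1 := hg.1.trans hg'.1.symm
      have h2 := hg.2.trans hg'.2.symm
      rw [r.src_arr, r.src_arr, r.obj.apply_eq_iff_eq] at h1
      rw [r.tgt_arr, r.tgt_arr, r.obj.apply_eq_iff_eq] at h2
      exact congrArg r.arr (F.faithful g g' h1 h2 (by simpa using h))
    · obtain ⟨h, rfl⟩ := r'.arr.surjective h
      obtain ⟨h1, h2⟩ := hh
      rw [r'.src_arr, r'.obj.apply_eq_iff_eq, r.obj.symm_apply_apply] at h1
      rw [r'.tgt_arr, r'.obj.apply_eq_iff_eq, r.obj.symm_apply_apply] at h2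
      obtain ⟨g, rfl, rfl, rfl⟩ := F.full x y h h1 h2
      exact ⟨r.arr g, ⟨r.src_arr g, r.tgt_arr g⟩, by simp⟩

namespace DefinableGroupoid

variable (X : DefinableGroupoid L A)

/-- A definable groupoid as a groupoid on definable types. -/
def toGroupoidOn : GroupoidOn L A X.Obj X.Arr :=
  { X with
    defFun_src := X.defFun_src
    defFun_tgt := X.defFun_tgt
    defFun_inv := X.defFun_inv
    defFun_one := X.defFun_one
    defPred_comp := X.defPred_comp }

/-- A definable groupoid realizes itself. -/
def selfRealization : X.toGroupoidOn.Realization where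
  gpd := X
  obj := Equiv.refl _
  arr := Equiv.refl _
  defFun_obj := defFun_id
  defFun_arr := defFun_id
  src_arr _ := rfl
  tgt_arr _ := rfl
  one_obj _ := rfl
  comp_arr _ _ _ _ := rfl

/-- The conjugate `b ∘ k ∘ a⁻¹`. -/
def conj (a b k : X.Arr) (h : X.src k = X.src a) (h' : X.tgt k = X.src b) : X.Arr :=
  X.comp b (X.comp k (X.inv a) (h.trans (X.tgt_inv a).symm)) (h'.symm.trans (X.tgt_comp _ _ _).symm)

/-- The groupoid of sets underlying a definable groupoid. -/
abbrev toGroupoid : CategoryTheory.Groupoid X.Obj where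
  Hom x y := {g : X.Arr // X.src g = x ∧ X.tgt g = y}
  id x := ⟨X.one x, X.src_one x, X.tgt_one x⟩
  comp g h := ⟨X.comp h.1 g.1 (h.2.1.trans g.2.2.symm), (X.src_comp _ _ _).trans g.2.1,
    (X.tgt_comp _ _ _).trans h.2.2⟩
  inv g := ⟨X.inv g.1, (X.src_inv _).trans g.2.2, (X.tgt_inv _).trans g.2.1⟩
  id_comp := by
    rintro x y ⟨g, rfl, rfl⟩
    exact Subtype.ext (X.comp_one g)
  comp_id := by
    rintro x y ⟨g, rfl, rfl⟩
    exact Subtype.ext (X.one_comp g)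
  assoc f g h := Subtype.ext (X.comp_assoc h.1 g.1 f.1 _ _).symm
  inv_comp := by
    rintro x y ⟨g, rfl, rfl⟩
    exact Subtype.ext (X.comp_inv g)
  comp_inv := by
    rintro x y ⟨g, rfl, rfl⟩
    exact Subtype.ext (X.inv_comp g)

open CategoryTheory

theorem src_conj (a b k : X.Arr) (h h') : X.src (X.conj a b k h h') = X.tgt a := by
  simp [conj, X.src_comp, X.src_inv]

theorem tgt_conj (a b k : X.Arr) (h h') : X.tgt (X.conj a b k h h') = X.tgt b := by
  simp [conj, X.tgt_comp]

theorem conj_one (a : X.Arr) {x y : X.Obj} (hx : X.src a = x) (hy : X.tgt a = y) :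
    X.conj a a (X.one x) ((X.src_one x).trans hx.symm) ((X.tgt_one x).trans hx.symm) =
      X.one y := by
  subst hx hy
  let := X.toGroupoid
  let a' : X.src a ⟶ X.tgt a := ⟨a, rfl, rfl⟩
  have : (Groupoid.inv a' ≫ 𝟙 _) ≫ a' = 𝟙 _ := by simp
  exact congrArg Subtype.val this

/-- The inner factors `b⁻¹ ∘ b` cancel. The computation takes place in `toGroupoid`, where endpoints
are part of the type and `simp` can use the category axioms. -/
theorem conj_comp (a b c k l : X.Arr) (h₁ : X.src l = X.src b) (h₁' : X.tgt l = X.src c)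
    (h₂ : X.src k = X.src a) (h₂' : X.tgt k = X.src b) :
    X.conj a c (X.comp l k (h₁.trans h₂'.symm)) ((X.src_comp _ _ _).trans h₂)
        ((X.tgt_comp _ _ _).trans h₁') =
      X.comp (X.conj b c l h₁ h₁') (X.conj a b k h₂ h₂')
        ((X.src_conj _ _ _ _ _).trans (X.tgt_conj _ _ _ _ _).symm) := by
  let := X.toGroupoid
  let a' : X.src a ⟶ X.tgt a := ⟨a, rfl, rfl⟩
  let b' : X.src b ⟶ X.tgt b := ⟨b, rfl, rfl⟩
  let c' : X.src c ⟶ X.tgt c := ⟨c, rfl, rfl⟩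
  let k' : X.src a ⟶ X.src b := ⟨k, h₂, h₂'⟩
  let l' : X.src b ⟶ X.src c := ⟨l, h₁, h₁'⟩
  have : (Groupoid.inv a' ≫ (k' ≫ l')) ≫ c' =
      ((Groupoid.inv a' ≫ k') ≫ b') ≫ ((Groupoid.inv b' ≫ l') ≫ c') := by simp
  exact congrArg Subtype.val this

theorem conj_injective (a b k l : X.Arr) (h h' h₁ h₁')
    (e : X.conj a b k h h' = X.conj a b l h₁ h₁') : k = l := by
  let := X.toGroupoid
  let a' : X.src a ⟶ X.tgt a := ⟨a, rfl, rfl⟩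
  let b' : X.src b ⟶ X.tgt b := ⟨b, rfl, rfl⟩
  let k' : X.src a ⟶ X.src b := ⟨k, h, h'⟩
  let l' : X.src a ⟶ X.src b := ⟨l, h₁, h₁'⟩
  have : (Groupoid.inv a' ≫ k') ≫ b' = (Groupoid.inv a' ≫ l') ≫ b' := Subtype.ext e
  have : k' = l' := (cancel_epi (Groupoid.inv a')).1 ((cancel_mono b').1 this)
  exact congrArg Subtype.val this

/-- The solution is `b⁻¹ ∘ m ∘ a`. With `conj_injective`, it makes `pullbackMap` fully faithful. -/
theorem exists_conj_eq (a b m : X.Arr) (h : X.src m = X.tgt a) (h' : X.tgt m = X.tgt b) :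
    ∃ k h₁ h₂, X.conj a b k h₁ h₂ = m := by
  let := X.toGroupoid
  let a' : X.src a ⟶ X.tgt a := ⟨a, rfl, rfl⟩
  let b' : X.src b ⟶ X.tgt b := ⟨b, rfl, rfl⟩
  let m' : X.tgt a ⟶ X.tgt b := ⟨m, h, h'⟩
  have : (Groupoid.inv a' ≫ (a' ≫ m' ≫ Groupoid.inv b')) ≫ b' = m' := by simp
  exact ⟨_, (a' ≫ m' ≫ Groupoid.inv b').2.1, (a' ≫ m' ≫ Groupoid.inv b').2.2,
    congrArg Subtype.val this⟩

theorem defFun_conj {T : Type w} [DefSet L A T] {a b k : T → X.Arr} (ha : DefFun L A a)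
    (hb : DefFun L A b) (hk : DefFun L A k) (h : ∀ t, X.src (k t) = X.src (a t))
    (h' : ∀ t, X.tgt (k t) = X.src (b t)) :
    DefFun L A fun t => X.conj (a t) (b t) (k t) (h t) (h' t) :=
  X.defFun_comp hb (X.defFun_comp hk (X.defFun_inv.comp ha) _) _

variable {P P' : Type w} [DefSet L A P] [DefSet L A P'] {f : P → X.Obj} {f' : P' → X.Obj}

/-- The projection of the pullback along a surjective map. -/
def pullbackProj (hf : DefFun L A f) (surj : Function.Surjective f) :
    letI := DefSet.subtype (X.defPred_pullbackArr hf)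
    (X.pullbackOn hf).MoritaMap X.toGroupoidOn :=
  letI := DefSet.subtype (X.defPred_pullbackArr hf)
  { obj := f
    arr := fun g => g.1.2
    defFun_obj := hf
    defFun_arr := (defFun_val (X.defPred_pullbackArr hf)).snd
    src_arr := fun g => g.2.1
    tgt_arr := fun g => g.2.2
    arr_one := fun _ => rfl
    arr_comp := fun _ _ _ _ => rfl
    surjective_obj := surj
    faithful := fun _ _ h h' e => Subtype.ext (Prod.ext (Prod.ext h h') e)
    full := fun x y h hx hy => ⟨⟨((x, y), h), hx, hy⟩, rfl, rfl, rfl⟩ }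

/-- The Morita map between pullbacks along maps that differ by a definable natural isomorphism. -/
def pullbackMap (hf : DefFun L A f) (hf' : DefFun L A f') (φ : P → P') (hφ : DefFun L A φ)
    (surj : Function.Surjective φ) (θ : P → X.Arr) (hθ : DefFun L A θ)
    (src_θ : ∀ p, X.src (θ p) = f p) (tgt_θ : ∀ p, X.tgt (θ p) = f' (φ p)) :
    letI := DefSet.subtype (X.defPred_pullbackArr hf)
    letI := DefSet.subtype (X.defPred_pullbackArr hf')
    (X.pullbackOn hf).MoritaMap (X.pullbackOn hf') :=
  letI := DefSet.subtype (X.defPred_pullbackArr hf)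
  letI := DefSet.subtype (X.defPred_pullbackArr hf')
  have hval := defFun_val (X.defPred_pullbackArr hf)
  { obj := φ
    arr := fun g => ⟨((φ g.1.1.1, φ g.1.1.2), X.conj (θ g.1.1.1) (θ g.1.1.2) g.1.2
        (g.2.1.trans (src_θ _).symm) (g.2.2.trans (src_θ _).symm)),
      (X.src_conj _ _ _ (g.2.1.trans (src_θ _).symm) (g.2.2.trans (src_θ _).symm)).trans (tgt_θ _),
      (X.tgt_conj _ _ _ (g.2.1.trans (src_θ _).symm) (g.2.2.trans (src_θ _).symm)).trans (tgt_θ _)⟩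
    defFun_obj := hφ
    defFun_arr := DefFun.subtypeMk _ (((hφ.comp hval.fst.fst).prodMk (hφ.comp hval.fst.snd)).prodMk
      (X.defFun_conj (hθ.comp hval.fst.fst) (hθ.comp hval.fst.snd) hval.snd _ _)) _
    src_arr := fun _ => rfl
    tgt_arr := fun _ => rfl
    arr_one := fun p => Subtype.ext (Prod.ext rfl
      (X.conj_one (θ p) (src_θ p) (tgt_θ p)))
    arr_comp := by
      rintro ⟨⟨⟨q, r⟩, l⟩, hl⟩ ⟨⟨⟨p, q'⟩, k⟩, hk⟩ e e'
      obtain rfl : q = q' := e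
      exact Subtype.ext (Prod.ext rfl (X.conj_comp _ _ _ _ _
        (hl.1.trans (src_θ q).symm) (hl.2.trans (src_θ r).symm)
        (hk.1.trans (src_θ p).symm) (hk.2.trans (src_θ q).symm)))
    surjective_obj := surj
    faithful := by
      rintro ⟨⟨⟨p, q⟩, k⟩, hk⟩ ⟨⟨⟨p', q'⟩, l⟩, hl⟩ e e' h
      obtain rfl : p = p' := e
      obtain rfl : q = q' := e'
      obtain rfl : k = l := X.conj_injective _ _ _ _
        (hk.1.trans (src_θ p).symm) (hk.2.trans (src_θ q).symm) (hl.1.trans (src_θ p).symm)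
        (hl.2.trans (src_θ q).symm) (congrArg (fun g => g.1.2) h)
      rfl
    full := by
      rintro p q ⟨⟨⟨p', q'⟩, m⟩, hm⟩ hp hq
      obtain rfl : p' = φ p := hp
      obtain rfl : q' = φ q := hq
      obtain ⟨k, h, h', rfl⟩ := X.exists_conj_eq (θ p) (θ q) m (hm.1.trans (tgt_θ p).symm)
        (hm.2.trans (tgt_θ q).symm)
      exact ⟨⟨((p, q), k), h.trans (src_θ p), h'.trans (src_θ q)⟩, rfl, rfl, rfl⟩ }

/-- Over a definable set of objects with finite choice, every definable groupoid is Morita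
equivalent to one whose set of objects is finite over the quotient. -/
theorem exists_moritaEquivalent_finiteOverQuot (h : FiniteChoice L A X.Obj) :
    ∃ Y : DefinableGroupoid L A, X.MoritaEquivalent Y ∧ Y.FiniteOverQuot := by
  -- The family is indexed by the objects, and its member at `x` is the isomorphism class of `x`.
  obtain ⟨T, hT, hTP, hne, ⟨N, hN⟩, hext⟩ := h X.Obj
    (fun x y => ∃ g : X.Arr, X.src g = x ∧ X.tgt g = y)
    (DefPred.exists (P := fun (p : X.Obj × X.Obj) (g : X.Arr) => X.src g = p.1 ∧ X.tgt g = p.2)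
      (((X.defFun_src.comp defFun_snd).eq defFun_fst.fst).and
        ((X.defFun_tgt.comp defFun_snd).eq defFun_fst.snd)))
  -- Isomorphic objects index the same class, so extensionality makes `T` constant on classes.
  have hTiso : ∀ g : X.Arr, T (X.src g) = T (X.tgt g) := fun g =>
    hext _ _ (funext fun y => propext
      ⟨fun hy => X.isoSetoid.trans (X.isoSetoid.symm ⟨g, rfl, rfl⟩) hy,
        fun hy => X.isoSetoid.trans ⟨g, rfl, rfl⟩ hy⟩)
  -- The objects of `Y` are those chosen in their own class.
  have hQ : DefPred L A fun x : X.Obj => T x x := hT.comp (defFun_id.prodMk defFun_id)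
  have hQ' : DefPred L A fun g : X.Arr => T (X.tgt g) (X.tgt g) := hQ.comp X.defFun_tgt
  let := DefSet.subtype hQ
  let := DefSet.subtype hQ'
  have hf := X.defFun_src.comp (defFun_val hQ')
  have hf' := defFun_val hQ
  let := DefSet.subtype (X.defPred_pullbackArr hf)
  let := DefSet.subtype (X.defPred_pullbackArr hf')
  obtain ⟨r⟩ := (X.pullbackOn hf).nonempty_realization
  obtain ⟨r'⟩ := (X.pullbackOn hf').nonempty_realization
  -- The bridge is the pullback of `X` along the source map on arrows ending in `Y`; the natural
  -- isomorphism from source to target is the tautological one, `θ g = g`.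
  refine ⟨r'.gpd, ⟨r.gpd, ⟨(X.pullbackProj hf fun x => ?_).toMoritaMorphism r X.selfRealization⟩,
    ⟨(X.pullbackMap hf hf' (fun g => ⟨X.tgt g.1, g.2⟩)
      (DefFun.subtypeMk hQ (X.defFun_tgt.comp (defFun_val hQ')) _) (fun x => ?_)
      Subtype.val (defFun_val hQ') (fun _ => rfl) fun _ => rfl).toMoritaMorphism r r'⟩⟩,
    N, fun q => ?_⟩
  · obtain ⟨y, hy⟩ := hne x ⟨x, X.one x, X.src_one x, X.tgt_one x⟩
    obtain ⟨g, rfl, rfl⟩ := hTP _ _ hy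
    exact ⟨⟨g, hTiso g ▸ hy⟩, rfl⟩
  · exact ⟨⟨X.one x.1, by simpa only [X.tgt_one] using x.2⟩, Subtype.ext (X.tgt_one _)⟩
  · obtain ⟨y, rfl⟩ := Quotient.exists_rep q
    have inj : Function.Injective fun y => (r'.obj.symm y).1 :=
      Subtype.val_injective.comp r'.obj.symm.injective
    -- The fibre through `y` embeds in `T y`: an object `z` of it satisfies `T z z`, and `T z = T
    -- y`.
    rw [← inj.encard_image]
    refine (Set.encard_le_encard ?_).trans (hN (r'.obj.symm y).1)
    rintro _ ⟨z, hz, rfl⟩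
    obtain ⟨k, hk, hk'⟩ := Quotient.exact hz
    obtain ⟨g, rfl⟩ := r'.arr.surjective k
    rw [r'.src_arr] at hk
    rw [r'.tgt_arr] at hk'
    subst hk hk'
    have e := hTiso g.1.2
    rw [g.2.1, g.2.2] at e
    simp only [Equiv.symm_apply_apply]
    change T g.1.1.2.1 g.1.1.1.1
    rw [← e]
    exact g.1.1.1.2

end DefinableGroupoid

end

end DefGroupoid

theorem mainTheorem9 {L : FirstOrder.Language.{u, v}} {U : Type w} [L.Structure U]
    (M : Set U) (hM : StronglyMinimal L M) (hacl : (acl L (∅ : Set U) ∩ M).Nonempty) :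
    (∀ X : DefinableGroupoid L (Set.univ : Set U), (∀ x ∈ X.Obj, ∀ i, x i ∈ M) →
      ∃ Y : DefinableGroupoid L (Set.univ : Set U), X.MoritaEquivalent Y ∧ Y.FiniteOverQuot) ∧
    (∀ K : Set U, K.Definable₁ L M → (acl L K ∩ M).Infinite →
      ∀ X : DefinableGroupoid L K, (∀ x ∈ X.Obj, ∀ i, x i ∈ M) →
        ∃ Y : DefinableGroupoid L K, X.MoritaEquivalent Y ∧ Y.FiniteOverQuot) := by
  have key : ∀ K : Set U, K.Definable₁ L M → (acl L K ∩ M).Infinite →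
      ∀ X : DefinableGroupoid L K, (∀ x ∈ X.Obj, ∀ i, x i ∈ M) →
        ∃ Y : DefinableGroupoid L K, X.MoritaEquivalent Y ∧ Y.FiniteOverQuot :=
    fun K hK hinf X hX => X.exists_moritaEquivalent_finiteOverQuot
      (FiniteChoice.of_subset_pow hK (hM.finiteChoice hK hinf) _ _ X.definable_Obj hX)
  -- The first claim is the case `K = univ`: every point is then algebraic, so `acl L K ∩ M` is the
  -- infinite set `M`.
  refine ⟨key _ ?_ ?_, key⟩
  · obtain ⟨-, φ, hφ, -⟩ := hM
    refine Set.definable_iff_exists_formula_sum.2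
      ⟨φ.relabel (Sum.map (fun a => ⟨a, trivial⟩) fun _ => 0), ?_⟩
    ext x
    rw [Set.mem_ofPred_eq, Set.mem_ofPred_eq, hφ, Set.mem_ofPred_eq,
      Language.Formula.realize_relabel]
    refine iff_of_eq (congrArg _ (funext fun i => ?_))
    rcases i with i | i <;> rfl
  · refine hM.1.mono fun x hx =>
      ⟨⟨{x}, Set.Definable.singleton_of_mem L (Set.mem_univ x), Set.finite_singleton x, rfl⟩, hx⟩
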